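/- Write $\sigma(z)=(1+e^{-z})^{-1}$, $\Pi_{[0,1]}(z)=\max(0,\min(1,z))$ and $\widetilde\sigma(z;\alpha)=\Pi_{[0,1]}\bigl(\tfrac12(1+\tfrac z\alpha)\bigr)$. Let $\mathrm{PL}_3$ be the set of all continuous functions $g:\mathbb R\to\mathbb R$ for which there are points $(x_1,y_1),\dots,(x_4,y_4)$ in $\mathbb R^2$ with $x_1<x_2<x_3<x_4$ such that $g$ equals the line through $(x_1,y_1),(x_2,y_2)$ on $(-\infty,x_2]$, the line through $(x_2,y_2),(x_3,y_3)$ on $(x_2,x_3]$, and the line through $(x_3,y_3),(x_4,y_4)$ on $(x_3,\infty)$. There is a universal constant $\alpha^\star$ with $2.5996<\alpha^\star<2.5997$ and $|\alpha^\star-\tfrac{80000}{30773}|<10^{-6}$ such that $\widetilde\sigma(\cdot\,;\alpha^\star)\in\mathrm{PL}_3$ and the following holds for every $d\ge 0$, $\beta_0\in\mathbb R$ and $\beta\in\mathbb R^d$, where $f(x)=\beta_0+\sum_{i=1}^d\beta_ix_i$ and $$\hat y_\alpha(x)=\Pi_{[0,1]}\Bigl(\tfrac12+\tfrac{\beta_0}{2\alpha}+\sum_{i=1}^d\tfrac{\beta_i}{2\alpha}x_i\Bigr)$$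 is the linearised additive model (LAM) with constant $\alpha$ induced by the logistic-regression model $\sigma\circ f$. 1. For all $x\in\mathbb R^d$, the LAM with constant $\alpha^\star$ satisfies $\hat y_{\alpha^\star}(x)=\widetilde\sigma(f(x);\alpha^\star)$, and the LAM with the rational constant $\tfrac{80000}{30773}$ satisfies $|\hat y_{80000/30773}(x)-\widetilde\sigma(f(x);\alpha^\star)|<10^{-6}$. 2. Suppose $\beta\ne0$ (so $d\ge1$). Put $G(R)=\dfrac{\pi^{(d-1)/2}}{\Gamma(\frac{d-1}2+1)}R^{d-1}$. For every $g\in\mathrm{PL}_3$ the limit $$E(g)=\lim_{R\to\infty}\frac1{G(R)}\int_{B(0,R)}\bigl(g(f(x))-\sigma(f(x))\bigr)^2\,dx\in[0,\infty]$$ exists, $E(\widetilde\sigma(\cdot\,;\alpha^\star))<\infty$, and $E(\widetilde\sigma(\cdot\,;\alpha^\star))<E(g)$ for every $g\in\mathrm{PL}_3$ other than $\widetilde\sigma(\cdot\,;\alpha^\star)$. Thus $\widetilde\sigma(\cdot\,;\alpha^\star)$ is the unique minimiser of $E$ over $\mathrm{PL}_3$. 3. Suppose $\beta\ne0$. Then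 $\widetilde\sigma(\cdot\,;\alpha^\star)$ also minimises over $g\in\mathrm{PL}_3$ the error $\int_{\mathbb R^d}(g(f(x))-\sigma(f(x)))^2\,dx\in[0,\infty]$ over the whole space, and if $d=1$ it is the unique minimiser. -/

import Mathlib

open MeasureTheory Filter Topology
open scoped ENNReal

noncomputable section

/-- The projector of the real line onto the unit interval. -/
def unitProj (z : ℝ) : ℝ := max 0 (min 1 z)

/-- The clipped linear link function with half-width `α`. -/
def clipSigmoid (α : ℝ) (z : ℝ) : ℝ := unitProj (1 / 2 * (1 + z / α))

/-- Slope of the `k`-th segment through the points `(x 0, y 0), …, (x 3, y 3)`. -/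
def plSlope (x y : Fin 4 → ℝ) (k : Fin 3) : ℝ :=
  (y k.succ - y k.castSucc) / (x k.succ - x k.castSucc)

/-- Intercept of the `k`-th segment through the points `(x 0, y 0), …, (x 3, y 3)`. -/
def plIntercept (x y : Fin 4 → ℝ) (k : Fin 3) : ℝ :=
  y k.castSucc - plSlope x y k * x k.castSucc

/-- The piecewise linear function with three pieces determined by the four points
`(x 0, y 0), …, (x 3, y 3)`; the outer pieces extend to infinity. -/
def plFun (x y : Fin 4 → ℝ) (t : ℝ) : ℝ :=
  if t ≤ x 1 then plSlope x y 0 * t + plIntercept x y 0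
  else if t ≤ x 2 then plSlope x y 1 * t + plIntercept x y 1
  else plSlope x y 2 * t + plIntercept x y 2

/-- The space of piecewise linear functions of one variable with three pieces. -/
def PL3 : Set (ℝ → ℝ) :=
  {g | ∃ x y : Fin 4 → ℝ, StrictMono x ∧ g = plFun x y}

/-- The additive log-odds `f(x) = β₀ + ∑ βᵢ φᵢ(xᵢ)` with shape functions `φᵢ`. -/
def additiveLogit {d : ℕ} (β₀ : ℝ) (β : EuclideanSpace ℝ (Fin d)) (φ : Fin d → ℝ → ℝ)
    (x : EuclideanSpace ℝ (Fin d)) : ℝ :=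
  β₀ + ∑ i, β i * φ i (x i)

/-- The linearised additive model relative to `additiveLogit β₀ β φ`, with constant `α`. -/
def linearisedModel {d : ℕ} (α β₀ : ℝ) (β : EuclideanSpace ℝ (Fin d)) (φ : Fin d → ℝ → ℝ)
    (x : EuclideanSpace ℝ (Fin d)) : ℝ :=
  unitProj (1 / 2 + β₀ / (2 * α) + ∑ i, β i / (2 * α) * φ i (x i))

/-- The log-odds of logistic regression: all shape functions are the identity. -/
def lrLogit {d : ℕ} (β₀ : ℝ) (β : EuclideanSpace ℝ (Fin d))
    (x : EuclideanSpace ℝ (Fin d)) : ℝ :=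
  additiveLogit β₀ β (fun _ => id) x

/-- The linearised model induced by logistic regression. -/
def lrLinearised {d : ℕ} (α β₀ : ℝ) (β : EuclideanSpace ℝ (Fin d))
    (x : EuclideanSpace ℝ (Fin d)) : ℝ :=
  linearisedModel α β₀ β (fun _ => id) x

/-- The squared error over the region `S` of the approximator `g ∘ f` of the logistic
regression model `σ ∘ f`, where `f = lrLogit β₀ β`; a value in `[0, ∞]`. -/
def regionError {d : ℕ} (β₀ : ℝ) (β : EuclideanSpace ℝ (Fin d))
    (S : Set (EuclideanSpace ℝ (Fin d))) (g : ℝ → ℝ) : ℝ≥0∞ :=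
  ∫⁻ x in S, ENNReal.ofReal
    ((g (lrLogit β₀ β x) - Real.sigmoid (lrLogit β₀ β x)) ^ 2)

/-- The volume of a ball of radius `R` in dimension `d - 1`. -/
def sliceVolume (d : ℕ) (R : ℝ) : ℝ :=
  Real.pi ^ (((d : ℝ) - 1) / 2) / Real.Gamma (((d : ℝ) - 1) / 2 + 1) * R ^ ((d : ℝ) - 1)

end

/-!
For the error `∫ (g - σ) ^ 2` over the real line, `PL3` splits into two kinds of functions: if an
outer piece differs from the limit of the sigmoid on its side the error is infinite, and otherwise
`g` is a ramp from `0` at `a` to `1` at `b`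
(`lineError_eq_top_or_eq_ramp`). With `S = log (1 + exp)`, the primitive of `σ`, the error of such
a ramp is `-1 - b + (b - a) / 3 + 2 ∫₀¹ S (a + (b - a) u) du` (`lineError_ramp`). Since `S` is
strictly convex, this is a strictly convex function of `(a, b)`, so a stationary point is its unique
minimiser (`rampError_lt`). At a symmetric point `(-α, α)` stationarity reads
`∫₀¹ u σ (-α + 2 α u) du = 1 / 3`. After an integration by parts the only integral left is
`∫₀^α log (1 + e ^ (-z)) dz`, which is `π ^ 2 / 12` plus a fast convergent dilogarithm series in
`e ^ (-α)`; rational bounds give a sign change between `2.599681` and `2.5996825`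
(`exists_stationary`).

In dimension `n + 1`, an orthonormal basis starting with `β / ‖β‖` turns the error over a region
into an integral over `t` of `(g - σ) ^ 2` at `β₀ + ‖β‖ t` times the volume of a slice of the region
(`exists_slicing`). For the ball of radius `R`, the slices divided by the central one have
measure at most `1` and tending to `1`, so the normalised errors converge to `‖β‖⁻¹` times the error
on the line (`tendsto_regionError_ball_div`). For the whole space the slice has the constant volume
`1` if `n = 0` and `∞` otherwise (`regionError_univ`). All three comparisons thus reduce to the one
on the line.
-/

/-! ### Softplus and integrals of the squared sigmoid -/

/-- The softplus function `log (1 + e ^ z)`, the primitive of the sigmoid vanishing at `-∞`. -/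
noncomputable def softplus (z : ℝ) : ℝ := Real.log (1 + Real.exp z)

/-- The continuous function that is `0` up to `a`, `1` from `b` on, and affine in between.
It has this meaning only for `a < b`. -/
noncomputable def ramp (a b t : ℝ) : ℝ := unitProj ((t - a) / (b - a))

theorem softplus_def : softplus = fun z => Real.log (1 + Real.exp z) := rfl

theorem hasDerivAt_softplus (z : ℝ) : HasDerivAt softplus (Real.sigmoid z) z := by
  have h := ((Real.hasDerivAt_exp z).const_add 1).log (by positivity)
  have e : Real.sigmoid z = Real.exp z / (1 + Real.exp z) := by
    rw [Real.sigmoid_def, Real.exp_neg]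
    have := Real.exp_pos z
    field_simp
    ring
  rw [e]
  exact h

theorem continuous_softplus : Continuous softplus :=
  continuous_iff_continuousAt.2 fun z => (hasDerivAt_softplus z).continuousAt

theorem softplus_eq_add (z : ℝ) : softplus z = z + softplus (-z) := by
  have h : 1 + Real.exp z = Real.exp z * (1 + Real.exp (-z)) := by
    rw [mul_add, ← Real.exp_add]; simp [add_comm]
  rw [softplus, h, Real.log_mul (by positivity) (by positivity), Real.log_exp, softplus]

/-- Strict convexity of `softplus`, as a tangent inequality. Exponentiated, it is the strict
convexity of `exp` between `0` and `p - q` with weights `1 - σ q` and `σ q`. -/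
theorem softplus_tangent_lt {p q : ℝ} (h : p ≠ q) :
    softplus q + Real.sigmoid q * (p - q) < softplus p := by
  have hs0 := Real.sigmoid_pos q
  have hs1 := Real.sigmoid_lt_one q
  have hc := strictConvexOn_exp.2 (Set.mem_univ 0) (Set.mem_univ (p - q))
    (sub_ne_zero.2 h).symm (sub_pos.2 hs1) hs0 (by ring)
  simp only [smul_eq_mul, mul_zero, zero_add, Real.exp_zero, mul_one] at hc
  have hq : (1 + Real.exp q) * (1 - Real.sigmoid q + Real.sigmoid q * Real.exp (p - q))
      = 1 + Real.exp p := by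
    rw [Real.sigmoid_def, Real.exp_neg, Real.exp_sub]
    have := Real.exp_pos q
    field_simp
    ring
  have h1 : softplus q + Real.sigmoid q * (p - q)
      = Real.log ((1 + Real.exp q) * Real.exp (Real.sigmoid q * (p - q))) := by
    rw [Real.log_mul (by positivity) (by positivity), Real.log_exp, softplus]
  rw [h1, softplus, ← hq]
  apply Real.log_lt_log (by positivity)
  gcongr

theorem softplus_tangent_le (p q : ℝ) :
    softplus q + Real.sigmoid q * (p - q) ≤ softplus p := by
  rcases eq_or_ne p q with rfl | h
  · simp
  · exact (softplus_tangent_lt h).le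

theorem tendsto_softplus_atBot : Tendsto softplus atBot (𝓝 0) := by
  have h : Tendsto (fun z => 1 + Real.exp z) atBot (𝓝 (1 + 0)) :=
    tendsto_const_nhds.add Real.tendsto_exp_atBot
  have := h.log (by norm_num)
  simpa [softplus_def] using this

theorem integrableOn_sigmoid_tail (b : ℝ) :
    IntegrableOn (fun t => (1 - Real.sigmoid t) ^ 2) (Set.Ioi b) ∧
    ∫ t in Set.Ioi b, (1 - Real.sigmoid t) ^ 2 = softplus (-b) - Real.sigmoid (-b) := by
  -- `1 - σ t = σ (-t)` and `σ ^ 2 = σ - σ'`.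
  have hd : ∀ t ∈ Set.Ici b, HasDerivAt (fun t => Real.sigmoid (-t) - softplus (-t))
      ((1 - Real.sigmoid t) ^ 2) t := fun t _ => by
    have h1 := (Real.hasDerivAt_sigmoid (-t)).comp t (hasDerivAt_neg t)
    have h2 := (hasDerivAt_softplus (-t)).comp t (hasDerivAt_neg t)
    have e : (1 - Real.sigmoid t) ^ 2
        = Real.sigmoid (-t) * (1 - Real.sigmoid (-t)) * -1 - Real.sigmoid (-t) * -1 := by
      rw [Real.sigmoid_neg]; ring
    rw [e]
    exact h1.sub h2
  have hl : Tendsto (fun t => Real.sigmoid (-t) - softplus (-t)) atTop (𝓝 0) := by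
    have h1 := Real.tendsto_sigmoid_atBot.comp tendsto_neg_atTop_atBot
    have h2 := tendsto_softplus_atBot.comp tendsto_neg_atTop_atBot
    simpa using h1.sub h2
  refine ⟨integrableOn_Ioi_deriv_of_nonneg' hd (fun _ _ => sq_nonneg _) hl, ?_⟩
  rw [integral_Ioi_of_hasDerivAt_of_nonneg' hd (fun _ _ => sq_nonneg _) hl]
  ring

theorem integrableOn_sigmoid_head (a : ℝ) :
    IntegrableOn (fun t => Real.sigmoid t ^ 2) (Set.Iic a) ∧
    ∫ t in Set.Iic a, Real.sigmoid t ^ 2 = softplus a - Real.sigmoid a := by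
  obtain ⟨h1, h2⟩ := integrableOn_sigmoid_tail (-a)
  have e : (fun t => (1 - Real.sigmoid t) ^ 2) = fun t => Real.sigmoid (-t) ^ 2 := by
    ext t; rw [Real.sigmoid_neg]
  rw [e] at h1
  simp only [e] at h2
  constructor
  · have h3 : IntegrableOn (fun t => Real.sigmoid (-t) ^ 2) (Set.Ici (-a)) :=
      (integrableOn_Ici_iff_integrableOn_Ioi enorm_ne_top).2 h1
    simpa using h3.comp_neg_Iic
  · rw [neg_neg] at h2
    rw [← h2, integral_comp_neg_Ioi (-a) (fun t => Real.sigmoid t ^ 2), neg_neg]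

/-- The value of `∫ (ramp a b - σ) ^ 2` over the real line for `a < b`, as a convex
function of `(a, b)`. -/
noncomputable def rampError (a b : ℝ) : ℝ :=
  -1 - b + (b - a) / 3 + 2 * ∫ u in (0 : ℝ)..1, softplus (a + (b - a) * u)

theorem integral_line_sub_sigmoid_sq {a b : ℝ} (hab : a < b) :
    ∫ t in a..b, ((t - a) / (b - a) - Real.sigmoid t) ^ 2
      = (b - a) / 3 - softplus b - softplus a - Real.sigmoid b + Real.sigmoid a
        + 2 * ∫ u in (0 : ℝ)..1, softplus (a + (b - a) * u) := by
  have hne : b - a ≠ 0 := (sub_pos.2 hab).ne'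
  have hT : ∀ t, HasDerivAt (fun t => ∫ z in a..t, softplus z) (softplus t) t := fun t =>
    intervalIntegral.integral_hasDerivAt_right (continuous_softplus.intervalIntegrable _ _)
      (continuous_softplus.stronglyMeasurableAtFilter _ _) continuous_softplus.continuousAt
  -- With `l` the line, `l * σ` has primitive `l * S - T / (b - a)`, and `σ ^ 2 = σ - σ'`.
  have hd : ∀ t ∈ Set.uIcc a b, HasDerivAt
      (fun t => (b - a) / 3 * ((t - a) / (b - a)) ^ 3
        - 2 * ((t - a) / (b - a) * softplus t - (∫ z in a..t, softplus z) / (b - a))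
        + softplus t - Real.sigmoid t)
      (((t - a) / (b - a) - Real.sigmoid t) ^ 2) t := fun t _ => by
    have hl : HasDerivAt (fun t => (t - a) / (b - a)) (1 / (b - a)) t :=
      ((hasDerivAt_id t).sub_const a).div_const _
    have := ((((hl.pow 3).const_mul ((b - a) / 3)).sub
      (((hl.mul (hasDerivAt_softplus t)).sub ((hT t).div_const (b - a))).const_mul 2)).add
      (hasDerivAt_softplus t)).sub (Real.hasDerivAt_sigmoid t)
    refine this.congr_deriv ?_
    push_cast
    field_simp
    ring
  rw [intervalIntegral.integral_eq_sub_of_hasDerivAt hd (Continuous.intervalIntegrable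
    (by have := continuous_sigmoid; fun_prop) _ _)]
  have hs : ∫ u in (0 : ℝ)..1, softplus (a + (b - a) * u)
      = (∫ z in a..b, softplus z) / (b - a) := by
    rw [intervalIntegral.integral_comp_add_mul _ hne]
    simp [div_eq_inv_mul]
  rw [hs]
  simp only [sub_self, zero_div, div_self hne, intervalIntegral.integral_same]
  ring

/-! ### The squared error of a ramp -/

theorem ramp_of_le {a b t : ℝ} (hab : a < b) (h : t ≤ a) : ramp a b t = 0 := by
  have : (t - a) / (b - a) ≤ 0 := div_nonpos_of_nonpos_of_nonneg (by linarith) (by linarith)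
  rw [ramp, unitProj, max_eq_left ((min_le_right _ _).trans this)]

theorem ramp_of_ge {a b t : ℝ} (hab : a < b) (h : b ≤ t) : ramp a b t = 1 := by
  have : 1 ≤ (t - a) / (b - a) := (one_le_div (by linarith)).2 (by linarith)
  rw [ramp, unitProj, min_eq_left this]; simp

theorem ramp_of_mem {a b t : ℝ} (hab : a < b) (h : t ∈ Set.Icc a b) :
    ramp a b t = (t - a) / (b - a) := by
  have h1 : (t - a) / (b - a) ≤ 1 := (div_le_one (by linarith)).2 (by linarith [h.2])
  have h0 : 0 ≤ (t - a) / (b - a) := div_nonneg (by linarith [h.1]) (by linarith)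
  rw [ramp, unitProj, min_eq_right h1, max_eq_right h0]

theorem continuous_ramp (a b : ℝ) : Continuous (ramp a b) := by
  unfold ramp unitProj; fun_prop

/-- The pointwise squared error of `g` as an approximation of the sigmoid. -/
noncomputable def sqError (g : ℝ → ℝ) (t : ℝ) : ℝ≥0∞ :=
  ENNReal.ofReal ((g t - Real.sigmoid t) ^ 2)

/-- The squared error of `g` as an approximation of the sigmoid over the real line, in `[0, ∞]`. -/
noncomputable def lineError (g : ℝ → ℝ) : ℝ≥0∞ := ∫⁻ t, sqError g t

theorem lineError_ramp {a b : ℝ} (hab : a < b) :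
    0 ≤ rampError a b ∧ lineError (ramp a b) = ENNReal.ofReal (rampError a b) := by
  set F : ℝ → ℝ := fun t => (ramp a b t - Real.sigmoid t) ^ 2 with hF
  have hFc : Continuous F := by
    have := continuous_sigmoid; have := continuous_ramp a b; fun_prop
  have e1 : Set.EqOn F (fun t => Real.sigmoid t ^ 2) (Set.Iic a) := fun t ht => by
    simp [hF, ramp_of_le hab ht]
  have e2 : Set.EqOn F (fun t => ((t - a) / (b - a) - Real.sigmoid t) ^ 2) (Set.uIcc a b) :=
    fun t ht => by
      rw [Set.uIcc_of_le hab.le] at ht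
      simp [hF, ramp_of_mem hab ht]
  have e3 : Set.EqOn F (fun t => (1 - Real.sigmoid t) ^ 2) (Set.Ioi b) := fun t ht => by
    simp [hF, ramp_of_ge hab (le_of_lt ht)]
  have i1 : IntegrableOn F (Set.Iic a) :=
    (integrableOn_sigmoid_head a).1.congr_fun e1.symm measurableSet_Iic
  have i3 : IntegrableOn F (Set.Ioi b) :=
    (integrableOn_sigmoid_tail b).1.congr_fun e3.symm measurableSet_Ioi
  have i2 : IntegrableOn F (Set.Ioc a b) := (hFc.intervalIntegrable a b).1
  have i1b : IntegrableOn F (Set.Iic b) := by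
    rw [← Set.Iic_union_Ioc_eq_Iic hab.le]; exact i1.union i2
  have hint : Integrable F := by
    rw [← integrableOn_univ, ← Set.Iic_union_Ioi (a := b)]; exact i1b.union i3
  suffices h : ∫ t, F t = rampError a b by
    refine ⟨h ▸ integral_nonneg fun _ => sq_nonneg _, ?_⟩
    simp only [lineError, sqError]
    rw [← ofReal_integral_eq_lintegral_ofReal hint (ae_of_all _ fun _ => sq_nonneg _), h]
  rw [← intervalIntegral.integral_Iic_add_Ioi i1b i3]
  have hs : ∫ t in Set.Iic b, F t = (∫ t in Set.Iic a, F t) + ∫ t in a..b, F t := by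
    rw [← intervalIntegral.integral_Iic_sub_Iic i1 i1b]; ring
  rw [hs, setIntegral_congr_fun measurableSet_Iic e1, setIntegral_congr_fun measurableSet_Ioi e3,
    intervalIntegral.integral_congr e2, (integrableOn_sigmoid_head a).2,
    (integrableOn_sigmoid_tail b).2, integral_line_sub_sigmoid_sq hab, rampError,
    Real.sigmoid_neg, softplus_eq_add b]
  ring

/-! ### The optimal ramp -/

/-- Global optimality of a stationary point: `rampError` is a linear term plus an average of the
strictly convex `softplus` at points depending affinely on `(a, b)`, so the tangent inequality at
`(-α, α)` is strict. By the symmetry `σ (-z) = 1 - σ z` the two stationarity equations at `(-α, α)`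
reduce to the single hypothesis `hα`. -/
theorem rampError_lt {α : ℝ}
    (hα : ∫ u in (0 : ℝ)..1, u * Real.sigmoid (-α + 2 * α * u) = 1 / 3) {a b : ℝ}
    (hne : a ≠ -α ∨ b ≠ α) : rampError (-α) α < rampError a b := by
  have hσ := continuous_sigmoid
  have hS := continuous_softplus
  have hsum : ∫ u in (0 : ℝ)..1, Real.sigmoid (-α + 2 * α * u) = 1 / 2 := by
    have h1 := intervalIntegral.integral_comp_sub_left
      (fun u => Real.sigmoid (-α + 2 * α * u)) (a := 0) (b := 1) 1
    have h2 : ∀ u : ℝ, Real.sigmoid (-α + 2 * α * (1 - u))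
        = 1 - Real.sigmoid (-α + 2 * α * u) := fun u => by
      rw [← Real.sigmoid_neg]; congr 1; ring
    simp only [h2] at h1
    rw [intervalIntegral.integral_sub (by simp)
      (Continuous.intervalIntegrable (by fun_prop) _ _)] at h1
    simp at h1
    linarith
  have hlt : ∫ u in (0 : ℝ)..1, (softplus (-α + 2 * α * u)
        + Real.sigmoid (-α + 2 * α * u) * (a + (b - a) * u - (-α + 2 * α * u)))
      < ∫ u in (0 : ℝ)..1, softplus (a + (b - a) * u) := by
    apply intervalIntegral.integral_lt_integral_of_continuousOn_of_le_of_exists_lt one_pos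
    · exact Continuous.continuousOn (by fun_prop)
    · exact Continuous.continuousOn (by fun_prop)
    · exact fun u _ => softplus_tangent_le _ _
    · rcases hne with h | h
      · exact ⟨0, by simp, softplus_tangent_lt (by simpa using h)⟩
      · refine ⟨1, by simp, softplus_tangent_lt ?_⟩
        ring_nf
        exact h
  have heq : ∫ u in (0 : ℝ)..1, (softplus (-α + 2 * α * u)
        + Real.sigmoid (-α + 2 * α * u) * (a + (b - a) * u - (-α + 2 * α * u)))
      = (∫ u in (0 : ℝ)..1, softplus (-α + 2 * α * u)) + (a + α) / 2 + (b - a - 2 * α) / 3 := by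
    have : (fun u => softplus (-α + 2 * α * u)
        + Real.sigmoid (-α + 2 * α * u) * (a + (b - a) * u - (-α + 2 * α * u)))
      = fun u => softplus (-α + 2 * α * u) + ((a + α) * Real.sigmoid (-α + 2 * α * u)
        + (b - a - 2 * α) * (u * Real.sigmoid (-α + 2 * α * u))) := by
      ext u; ring
    rw [this, intervalIntegral.integral_add (Continuous.intervalIntegrable (by fun_prop) _ _)
      (Continuous.intervalIntegrable (by fun_prop) _ _),
      intervalIntegral.integral_add (Continuous.intervalIntegrable (by fun_prop) _ _)
      (Continuous.intervalIntegrable (by fun_prop) _ _), intervalIntegral.integral_const_mul,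
      intervalIntegral.integral_const_mul, hsum, hα]
    ring
  rw [heq] at hlt
  have h0 : ∫ u in (0 : ℝ)..1, softplus (-α + (α - -α) * u)
      = ∫ u in (0 : ℝ)..1, softplus (-α + 2 * α * u) := by
    congr 1; ext u; congr 1; ring
  rw [rampError, rampError, h0]
  linarith

/-! ### Functions of finite error in `PL3` -/

theorem lintegral_line_Iic_eq_top {m k : ℝ} (h : m ≠ 0 ∨ k ≠ 0) (a : ℝ) :
    ∫⁻ t in Set.Iic a, ENNReal.ofReal ((m * t + k - Real.sigmoid t) ^ 2) = ⊤ := by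
  obtain ⟨ε, hε, hev⟩ : ∃ ε > 0, ∀ᶠ t in atBot, ε ≤ |m * t + k - Real.sigmoid t| := by
    by_cases hm : m = 0
    · have hk : k ≠ 0 := h.resolve_left (by simpa using hm)
      have ht : Tendsto (fun t => |m * t + k - Real.sigmoid t|) atBot (𝓝 |k|) := by
        have := (tendsto_const_nhds (x := k)).sub Real.tendsto_sigmoid_atBot
        simpa [hm] using this.abs
      exact ⟨|k| / 2, by positivity, (ht.eventually (lt_mem_nhds
        (half_lt_self (abs_pos.2 hk)))).mono fun _ h => h.le⟩
    · have ht : Tendsto (fun t => |m| * |t|) atBot atTop :=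
        tendsto_abs_atBot_atTop.const_mul_atTop (abs_pos.2 hm)
      refine ⟨1, one_pos, (ht.eventually_ge_atTop (2 + |k|)).mono fun t h => ?_⟩
      have h1 := Real.sigmoid_pos t
      have h2 := Real.sigmoid_lt_one t
      rw [← abs_mul] at h
      have h3 : |m * t| ≤ |m * t + k - Real.sigmoid t| + (|k| + |Real.sigmoid t|) := by
        calc |m * t| = |(m * t + k - Real.sigmoid t) + (-k + Real.sigmoid t)| := by ring_nf
          _ ≤ _ := (abs_add_le _ _).trans (by
            gcongr; exact (abs_add_le _ _).trans (by rw [abs_neg]))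
      rw [abs_of_pos h1] at h3
      linarith
  obtain ⟨N, hN⟩ := eventually_atBot.1 hev
  rw [eq_top_iff]
  calc (⊤ : ℝ≥0∞) = ∫⁻ t in Set.Iic (min a N), ENNReal.ofReal (ε ^ 2) := by
        rw [setLIntegral_const, Real.volume_Iic, ENNReal.mul_top]
        simpa using hε.ne'
    _ ≤ ∫⁻ t in Set.Iic (min a N), ENNReal.ofReal ((m * t + k - Real.sigmoid t) ^ 2) := by
        apply setLIntegral_mono' measurableSet_Iic
        intro t ht
        apply ENNReal.ofReal_le_ofReal
        rw [← sq_abs (m * t + k - _)]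
        have := hN t (le_trans ht (min_le_right _ _))
        gcongr
    _ ≤ _ := lintegral_mono_set (Set.Iic_subset_Iic.2 (min_le_left _ _))

theorem lintegral_line_Ioi_eq_top {m k : ℝ} (h : m ≠ 0 ∨ k ≠ 1) (b : ℝ) :
    ∫⁻ t in Set.Ioi b, ENNReal.ofReal ((m * t + k - Real.sigmoid t) ^ 2) = ⊤ := by
  have h1 := lintegral_line_Iic_eq_top (m := m) (k := 1 - k)
    (h.imp_right fun h => sub_ne_zero.2 h.symm) (-(b + 1))
  have h2 := (Measure.measurePreserving_neg (volume : Measure ℝ)).setLIntegral_comp_preimage_emb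
    (MeasurableEquiv.neg ℝ).measurableEmbedding
    (fun t => ENNReal.ofReal ((m * t + (1 - k) - Real.sigmoid t) ^ 2)) (Set.Iic (-(b + 1)))
  rw [h1] at h2
  rw [eq_top_iff, ← h2]
  refine (lintegral_mono fun t => ?_).trans
    (lintegral_mono_set (s := Neg.neg ⁻¹' Set.Iic (-(b + 1))) fun t ht => ?_)
  · rw [Real.sigmoid_neg]
    exact (congrArg ENNReal.ofReal (by ring)).le
  · have : -t ≤ -(b + 1) := ht
    exact Set.mem_Ioi.2 (by linarith)

/-- A function in `PL3` has finite error only if its outer pieces are the constants `0` and `1`,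
which leaves exactly the ramps. -/
theorem lineError_eq_top_or_eq_ramp {g : ℝ → ℝ} (hg : g ∈ PL3) :
    lineError g = ⊤ ∨ ∃ a b, a < b ∧ g = ramp a b := by
  obtain ⟨x, y, hx, rfl⟩ := hg
  have h12 : x 1 < x 2 := hx (by decide)
  by_cases h0 : plSlope x y 0 ≠ 0 ∨ plIntercept x y 0 ≠ 0
  · left
    rw [eq_top_iff, ← lintegral_line_Iic_eq_top h0 (x 1)]
    simp only [lineError, sqError]
    refine (setLIntegral_mono' measurableSet_Iic fun t ht => ?_).trans (setLIntegral_le_lintegral _ _)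
    rw [plFun, if_pos (Set.mem_Iic.1 ht)]
  by_cases h2 : plSlope x y 2 ≠ 0 ∨ plIntercept x y 2 ≠ 1
  · left
    rw [eq_top_iff, ← lintegral_line_Ioi_eq_top h2 (x 2)]
    simp only [lineError, sqError]
    refine (setLIntegral_mono' measurableSet_Ioi fun t ht => ?_).trans (setLIntegral_le_lintegral _ _)
    rw [plFun, if_neg (not_le.2 (h12.trans ht)), if_neg (not_le.2 ht)]
  right
  push Not at h0 h2
  obtain ⟨s0, i0⟩ := h0
  obtain ⟨s2, i2⟩ := h2
  have h01 : x 0 < x 1 := hx (by decide)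
  have y0 : y 0 = 0 := by
    have := i0; rw [plIntercept, s0] at this; simpa using this
  have y1 : y 1 = 0 := by
    rw [plSlope, div_eq_zero_iff] at s0
    rcases s0 with h | h
    · have : y 1 - y 0 = 0 := h
      linarith
    · have : x 1 - x 0 = 0 := h
      linarith
  have y2 : y 2 = 1 := by
    have := i2; rw [plIntercept, s2, zero_mul, sub_zero] at this; exact this
  have s1 : plSlope x y 1 = 1 / (x 2 - x 1) := by
    have : plSlope x y 1 = (y 2 - y 1) / (x 2 - x 1) := rfl
    rw [this, y1, y2, sub_zero]
  have i1 : plIntercept x y 1 = -(1 / (x 2 - x 1)) * x 1 := by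
    have : plIntercept x y 1 = y 1 - plSlope x y 1 * x 1 := rfl
    rw [this, s1, y1]; ring
  refine ⟨x 1, x 2, h12, funext fun t => ?_⟩
  rw [plFun]
  split_ifs with ha hb
  · rw [s0, i0, ramp_of_le h12 ha]; ring
  · rw [s1, i1, ramp_of_mem h12 ⟨(not_le.1 ha).le, hb⟩]; ring
  · rw [s2, i2, ramp_of_ge h12 (not_le.1 hb).le]; ring

theorem clipSigmoid_eq_ramp {α : ℝ} (hα : 0 < α) : clipSigmoid α = ramp (-α) α := by
  ext t
  rw [clipSigmoid, ramp]; congr 1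
  field_simp; ring

theorem ramp_mem_PL3 {a b : ℝ} (hab : a < b) : ramp a b ∈ PL3 := by
  refine ⟨![a - 1, a, b, b + 1], ![0, 0, 1, 1], ?_, funext fun t => ?_⟩
  · rw [Fin.strictMono_iff_lt_succ]
    intro i
    fin_cases i <;> simp [hab]
  have s0 : plSlope ![a - 1, a, b, b + 1] ![0, 0, 1, 1] 0 = 0 := by simp [plSlope]
  have s1 : plSlope ![a - 1, a, b, b + 1] ![0, 0, 1, 1] 1 = 1 / (b - a) := by simp [plSlope]
  have s2 : plSlope ![a - 1, a, b, b + 1] ![0, 0, 1, 1] 2 = 0 := by simp [plSlope]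
  have i0 : plIntercept ![a - 1, a, b, b + 1] ![0, 0, 1, 1] 0 = 0 := by
    simp [plIntercept, s0]
  have i1 : plIntercept ![a - 1, a, b, b + 1] ![0, 0, 1, 1] 1 = -(1 / (b - a)) * a := by
    simp [plIntercept, s1]
  have i2 : plIntercept ![a - 1, a, b, b + 1] ![0, 0, 1, 1] 2 = 1 := by
    simp [plIntercept, s2]
  rw [plFun]
  simp only [s0, s1, s2, i0, i1, i2]
  split_ifs with ha hb
  · rw [ramp_of_le hab (by simpa using ha)]; ring
  · rw [ramp_of_mem hab ⟨by simpa using (not_le.1 ha).le, by simpa using hb⟩]; ring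
  · rw [ramp_of_ge hab (by simpa using (not_le.1 hb).le)]; ring

theorem lineError_clipSigmoid_lt {α : ℝ} (hα : 0 < α)
    (h : ∫ u in (0 : ℝ)..1, u * Real.sigmoid (-α + 2 * α * u) = 1 / 3) {g : ℝ → ℝ}
    (hg : g ∈ PL3) (hne : g ≠ clipSigmoid α) : lineError (clipSigmoid α) < lineError g := by
  have h0 : -α < α := by linarith
  rw [clipSigmoid_eq_ramp hα] at hne ⊢
  rcases lineError_eq_top_or_eq_ramp hg with h1 | ⟨a, b, hab, rfl⟩
  · rw [h1, (lineError_ramp h0).2]; exact ENNReal.ofReal_lt_top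
  have hlt : rampError (-α) α < rampError a b := rampError_lt h (by
    by_contra! hc
    exact hne (by rw [hc.1, hc.2]))
  rw [(lineError_ramp h0).2, (lineError_ramp hab).2]
  exact (ENNReal.ofReal_lt_ofReal_iff ((lineError_ramp h0).1.trans_lt hlt)).2 hlt

/-! ### Location of the optimal half-width -/

/-- Integration by parts, folded to `[0, α]` by `softplus z = z + softplus (-z)`. -/
theorem integral_mul_sigmoid {α : ℝ} (hα : α ≠ 0) :
    ∫ u in (0 : ℝ)..1, u * Real.sigmoid (-α + 2 * α * u)
      = (α * (α + softplus (-α)) - α ^ 2 / 4 - ∫ z in (0 : ℝ)..α, softplus (-z)) / (2 * α ^ 2) := by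
  have hS := continuous_softplus
  have hσ := continuous_sigmoid
  have hT : ∀ t, HasDerivAt (fun t => ∫ z in (0 : ℝ)..t, softplus z) (softplus t) t := fun t =>
    intervalIntegral.integral_hasDerivAt_right (hS.intervalIntegrable _ _)
      (hS.stronglyMeasurableAtFilter _ _) hS.continuousAt
  have hd : ∀ u ∈ Set.uIcc (0 : ℝ) 1, HasDerivAt
      (fun u => u * softplus (-α + 2 * α * u) / (2 * α)
        - (∫ z in (0 : ℝ)..(-α + 2 * α * u), softplus z) / (4 * α ^ 2))
      (u * Real.sigmoid (-α + 2 * α * u)) u := fun u _ => by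
    have hv : HasDerivAt (fun u : ℝ => -α + 2 * α * u) (2 * α) u := by
      simpa using ((hasDerivAt_id u).const_mul (2 * α)).const_add (-α)
    have := (((hasDerivAt_id u).mul ((hasDerivAt_softplus _).comp u hv)).div_const (2 * α)).sub
      (((hT _).comp u hv).div_const (4 * α ^ 2))
    refine this.congr_deriv ?_
    simp only [id, Function.comp]
    field_simp
    ring
  rw [intervalIntegral.integral_eq_sub_of_hasDerivAt hd
    (Continuous.intervalIntegrable (by fun_prop) _ _)]
  have e1 : ∫ z in (0 : ℝ)..α, softplus z = α ^ 2 / 2 + ∫ z in (0 : ℝ)..α, softplus (-z) := by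
    rw [← show ∫ z in (0 : ℝ)..α, z = α ^ 2 / 2 by simp, ← intervalIntegral.integral_add
      (Continuous.intervalIntegrable (by fun_prop) _ _)
      (Continuous.intervalIntegrable (by fun_prop) _ _)]
    exact intervalIntegral.integral_congr fun z _ => softplus_eq_add z
  have e2 : ∫ z in (0 : ℝ)..(-α), softplus z = -∫ z in (0 : ℝ)..α, softplus (-z) := by
    rw [intervalIntegral.integral_comp_neg, intervalIntegral.integral_symm, neg_zero]
  have e3 : -α + 2 * α * 1 = α := by ring
  rw [e3, mul_zero, add_zero, e1, e2, softplus_eq_add α]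
  field_simp
  ring

/-- Termwise integration of `log (1 + e ^ (-z)) = ∑ (-1) ^ n e ^ (-(n + 1) z) / (n + 1)`. At `z = 0`
the series converges only conditionally, so summability is used for the integrals of the norms. -/
theorem hasSum_integral_softplus_neg {w : ℝ} (hw : 0 ≤ w) :
    HasSum (fun n : ℕ => (-1) ^ n * (1 - Real.exp (-w) ^ (n + 1)) / ((n : ℝ) + 1) ^ 2)
      (∫ z in (0 : ℝ)..w, softplus (-z)) := by
  have hexp (n : ℕ) : ∫ z in (0 : ℝ)..w, Real.exp (-z) ^ (n + 1)
      = (1 - Real.exp (-w) ^ (n + 1)) / (n + 1) := by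
    have hn : (n : ℝ) + 1 ≠ 0 := by positivity
    have hd : ∀ z ∈ Set.uIcc 0 w, HasDerivAt (fun z => -(Real.exp (-z) ^ (n + 1)) / ((n : ℝ) + 1))
        (Real.exp (-z) ^ (n + 1)) z := fun z _ => by
      have := ((((hasDerivAt_neg z).exp).pow (n + 1)).neg).div_const ((n : ℝ) + 1)
      refine this.congr_deriv ?_
      push_cast
      field_simp
      simp [pow_succ]
    rw [intervalIntegral.integral_eq_sub_of_hasDerivAt hd
      (Continuous.intervalIntegrable (by fun_prop) _ _)]
    simp only [neg_zero, Real.exp_zero, one_pow]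
    ring
  set F : ℕ → ℝ → ℝ := fun n z => (-1) ^ n / ((n : ℝ) + 1) * Real.exp (-z) ^ (n + 1) with hF
  have hFi (n : ℕ) : ∫ z in (0 : ℝ)..w, F n z
      = (-1) ^ n * (1 - Real.exp (-w) ^ (n + 1)) / ((n : ℝ) + 1) ^ 2 := by
    simp only [hF]
    rw [intervalIntegral.integral_const_mul, hexp]
    field_simp
  have hnorm (n : ℕ) : ∫ z in Set.Ioc 0 w, ‖F n z‖
      = (1 - Real.exp (-w) ^ (n + 1)) / ((n : ℝ) + 1) ^ 2 := by
    have : ∀ z, ‖F n z‖ = 1 / ((n : ℝ) + 1) * Real.exp (-z) ^ (n + 1) := fun z => by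
      simp only [hF, norm_mul, norm_div, norm_pow, norm_neg, norm_one, one_pow, Real.norm_eq_abs,
        Real.abs_exp]
      rw [abs_of_pos (by positivity : (0 : ℝ) < n + 1)]
    simp only [this]
    rw [← intervalIntegral.integral_of_le hw, intervalIntegral.integral_const_mul, hexp]
    field_simp
  have h := hasSum_integral_of_summable_integral_norm (μ := volume.restrict (Set.Ioc 0 w)) (F := F)
    (fun n => (Continuous.integrableOn_Ioc (by simp only [hF]; fun_prop))) ?_
  · have hs : ∫ z in Set.Ioc 0 w, ∑' n, F n z = ∫ z in (0 : ℝ)..w, softplus (-z) := by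
      rw [intervalIntegral.integral_of_le hw]
      refine setIntegral_congr_fun measurableSet_Ioc fun z hz => ?_
      have hq : Real.exp (-z) < 1 := Real.exp_lt_one_iff.2 (neg_neg_of_pos hz.1)
      have hl := (Real.hasSum_pow_div_log_of_abs_lt_one (x := -Real.exp (-z))
        (by rwa [abs_neg, Real.abs_exp])).neg
      rw [neg_neg, sub_neg_eq_add] at hl
      rw [softplus, ← hl.tsum_eq]
      refine tsum_congr fun n => ?_
      simp only [hF]
      rw [neg_pow (Real.exp (-z)), pow_succ (-1 : ℝ)]
      ring
    rw [hs] at h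
    convert! h using 2 with n
    rw [← hFi, intervalIntegral.integral_of_le hw]
  · refine Summable.of_nonneg_of_le (fun n => integral_nonneg fun _ => norm_nonneg _) (fun n => ?_)
      ((summable_nat_add_iff 1).2 (Real.summable_one_div_nat_pow.2 one_lt_two))
    rw [hnorm]
    push_cast
    gcongr
    linarith [pow_pos (Real.exp_pos (-w)) (n + 1)]

theorem hasSum_alternating_zeta_two :
    HasSum (fun n : ℕ => (-1 : ℝ) ^ n / ((n : ℝ) + 1) ^ 2) (Real.pi ^ 2 / 12) := by
  have hz := hasSum_zeta_two
  have he : HasSum (fun k : ℕ => 1 / ((2 * k : ℕ) : ℝ) ^ 2) (Real.pi ^ 2 / 24) := by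
    have := hz.div_const 4
    convert! this using 1
    · ext n; push_cast; ring
    · ring
  have ho : HasSum (fun k : ℕ => 1 / ((2 * k + 1 : ℕ) : ℝ) ^ 2) (Real.pi ^ 2 / 8) := by
    have hs : Summable (fun k : ℕ => 1 / ((2 * k + 1 : ℕ) : ℝ) ^ 2) :=
      hz.summable.comp_injective (i := fun k : ℕ => 2 * k + 1) fun a b h => by simpa using h
    have h1 := (he.even_add_odd (f := fun n : ℕ => 1 / (n : ℝ) ^ 2) hs.hasSum).unique hz
    have h2 := hs.hasSum
    rwa [show (∑' k : ℕ, 1 / ((2 * k + 1 : ℕ) : ℝ) ^ 2) = Real.pi ^ 2 / 8 by linarith] at h2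
  have ha : HasSum (fun n : ℕ => (-1 : ℝ) ^ (n + 1) / (n : ℝ) ^ 2)
      (-(Real.pi ^ 2 / 24) + Real.pi ^ 2 / 8) := by
    refine HasSum.even_add_odd ?_ ?_
    · convert! he.neg using 2 with k
      rw [pow_succ, pow_mul]; simp [neg_div]
    · convert! ho using 2 with k
      rw [pow_succ, pow_succ, pow_mul]; simp
  rw [← hasSum_nat_add_iff' 1] at ha
  simp only [Finset.range_one, Finset.sum_singleton] at ha
  convert! ha using 1
  · ext n
    push_cast
    rw [pow_succ (-1 : ℝ) (n + 1), pow_succ (-1 : ℝ) n]; simp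
  · simp; ring

/-- The integral is `π ^ 2 / 12` plus a dilogarithm at `-e ^ (-w)`, whose series is truncated here
with a geometric bound on the remainder. -/
theorem abs_integral_softplus_neg_sub_le {w : ℝ} (hw : 0 < w) (N : ℕ) :
    |(∫ z in (0 : ℝ)..w, softplus (-z)) - (Real.pi ^ 2 / 12
        - ∑ n ∈ Finset.range N, (-1) ^ n * Real.exp (-w) ^ (n + 1) / ((n : ℝ) + 1) ^ 2)|
      ≤ Real.exp (-w) ^ (N + 1) / (1 - Real.exp (-w)) := by
  set q := Real.exp (-w) with hq
  have hq0 : 0 < q := Real.exp_pos _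
  have hq1 : q < 1 := Real.exp_lt_one_iff.2 (by linarith)
  have h1 := hasSum_alternating_zeta_two.sub (hasSum_integral_softplus_neg hw.le)
  have h2 : HasSum (fun n : ℕ => (-1) ^ n * q ^ (n + 1) / ((n : ℝ) + 1) ^ 2)
      (Real.pi ^ 2 / 12 - ∫ z in (0 : ℝ)..w, softplus (-z)) := by
    convert! h1 using 2 with n
    rw [← hq]; ring
  have h3 := (hasSum_nat_add_iff' N).2 h2
  have hg : HasSum (fun n : ℕ => q ^ (n + N + 1)) (q ^ (N + 1) / (1 - q)) := by
    have := (hasSum_geometric_of_lt_one hq0.le hq1).mul_left (q ^ (N + 1))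
    rw [← div_eq_mul_inv] at this
    convert! this using 2 with n
    rw [← pow_add]; ring_nf
  have h4 := h3.norm_le_of_bounded hg fun n => by
    rw [norm_div, norm_mul, norm_pow, norm_neg, norm_one, one_pow, one_mul,
      Real.norm_of_nonneg (by positivity), Real.norm_of_nonneg (by positivity)]
    apply div_le_self (by positivity)
    have : (0 : ℝ) ≤ ((n + N : ℕ) : ℝ) := by positivity
    nlinarith
  rw [Real.norm_eq_abs, abs_sub_comm] at h4
  convert! h4 using 2
  ring

/-- A function of the half-width `w` whose zero is the half-width of the optimal symmetric ramp:
it is `2 w ^ 2` times the excess of `∫ u in 0..1, u * σ (-w + 2 w u)` over `1 / 3`. -/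
noncomputable def stationarity (w : ℝ) : ℝ :=
  w ^ 2 / 12 + w * softplus (-w) - ∫ z in (0 : ℝ)..w, softplus (-z)

theorem abs_stationarity_sub_le {w : ℝ} (hw : 0 < w) :
    |stationarity w - (w ^ 2 / 12 + w * ∑ n ∈ Finset.range 7,
        (-1) ^ n * Real.exp (-w) ^ (n + 1) / ((n : ℝ) + 1) - Real.pi ^ 2 / 12
        + ∑ n ∈ Finset.range 7, (-1) ^ n * Real.exp (-w) ^ (n + 1) / ((n : ℝ) + 1) ^ 2)|
      ≤ (1 + w) * (Real.exp (-w) ^ 8 / (1 - Real.exp (-w))) := by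
  have h1 := abs_integral_softplus_neg_sub_le hw 7
  have h2 := Real.abs_log_sub_add_sum_range_le (x := -Real.exp (-w))
    (by rw [abs_neg, Real.abs_exp]; exact Real.exp_lt_one_iff.2 (by linarith)) 7
  rw [abs_neg, Real.abs_exp, sub_neg_eq_add] at h2
  have h3 : (∑ n ∈ Finset.range 7, (-Real.exp (-w)) ^ (n + 1) / ((n : ℝ) + 1))
      = -∑ n ∈ Finset.range 7, (-1) ^ n * Real.exp (-w) ^ (n + 1) / ((n : ℝ) + 1) := by
    rw [← Finset.sum_neg_distrib]
    refine Finset.sum_congr rfl fun n _ => ?_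
    rw [neg_pow, pow_succ (-1 : ℝ)]
    ring
  rw [h3] at h2
  set A := ∑ n ∈ Finset.range 7, (-1) ^ n * Real.exp (-w) ^ (n + 1) / ((n : ℝ) + 1)
  set B := ∑ n ∈ Finset.range 7, (-1) ^ n * Real.exp (-w) ^ (n + 1) / ((n : ℝ) + 1) ^ 2
  set ε := Real.exp (-w) ^ (7 + 1) / (1 - Real.exp (-w))
  have h4 : |w * (-A + Real.log (1 + Real.exp (-w)))| ≤ w * ε := by
    rw [abs_mul, abs_of_pos hw]; gcongr
  rw [stationarity, softplus]
  rw [abs_le] at h1 h4 ⊢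
  constructor <;> nlinarith [h1.1, h1.2, h4.1, h4.2]

/-- Taylor bounds for `exp` on `[-1, 1]`, raised to the fourth power to reach arguments
in `[-4, 4]`. -/
theorem exp_four_mul_mem_Icc {x l u : ℝ} (hx : |x| ≤ 1) (hl0 : 0 ≤ l)
    (hl : l ≤ (∑ m ∈ Finset.range 12, x ^ m / (m.factorial : ℝ)) - 3 / 10 ^ 9)
    (hu : (∑ m ∈ Finset.range 12, x ^ m / (m.factorial : ℝ)) + 3 / 10 ^ 9 ≤ u) :
    Real.exp (4 * x) ∈ Set.Icc (l ^ 4) (u ^ 4) := by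
  have h := Real.exp_bound hx (n := 12) (by norm_num)
  have h1 : |x| ^ 12 * ((Nat.succ 12 : ℕ) / ((Nat.factorial 12 : ℕ) * (12 : ℕ)) : ℝ)
      ≤ 3 / 10 ^ 9 := by
    calc _ ≤ 1 * ((Nat.succ 12 : ℕ) / ((Nat.factorial 12 : ℕ) * (12 : ℕ)) : ℝ) := by
          gcongr; exact pow_le_one₀ (abs_nonneg _) hx
      _ ≤ 3 / 10 ^ 9 := by norm_num [Nat.factorial]
  have h2 := abs_le.1 (h.trans h1)
  have e : Real.exp (4 * x) = Real.exp x ^ 4 := by rw [← Real.exp_nat_mul]; norm_num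
  have hp := Real.exp_pos x
  rw [e]
  constructor
  · have : l ≤ Real.exp x := by linarith [h2.1]
    gcongr
  · have : Real.exp x ≤ u := by linarith [h2.2]
    gcongr

/-- Enclosure of `stationarity w` by polynomials in bounds `l ≤ e ^ (-w) ≤ u`. -/
theorem stationarity_mem_Icc {w l u : ℝ} (hw : 0 < w) (hl : 0 ≤ l) (hu : u < 1)
    (h : Real.exp (-w) ∈ Set.Icc l u) :
    stationarity w ∈ Set.Icc
      (w ^ 2 / 12 + w * (l - u ^ 2 / 2 + l ^ 3 / 3 - u ^ 4 / 4 + l ^ 5 / 5 - u ^ 6 / 6 + l ^ 7 / 7)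
        - 3.1415926536 ^ 2 / 12
        + (l - u ^ 2 / 4 + l ^ 3 / 9 - u ^ 4 / 16 + l ^ 5 / 25 - u ^ 6 / 36 + l ^ 7 / 49)
        - (1 + w) * (u ^ 8 / (1 - u)))
      (w ^ 2 / 12 + w * (u - l ^ 2 / 2 + u ^ 3 / 3 - l ^ 4 / 4 + u ^ 5 / 5 - l ^ 6 / 6 + u ^ 7 / 7)
        - 3.1415926535 ^ 2 / 12
        + (u - l ^ 2 / 4 + u ^ 3 / 9 - l ^ 4 / 16 + u ^ 5 / 25 - l ^ 6 / 36 + u ^ 7 / 49)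
        + (1 + w) * (u ^ 8 / (1 - u))) := by
  have hs := abs_stationarity_sub_le hw
  simp only [Finset.sum_range_succ, Finset.sum_range_zero] at hs
  norm_num at hs
  set q := Real.exp (-w)
  have hq0 : 0 < q := Real.exp_pos _
  have hL (n : ℕ) : l ^ n ≤ q ^ n := pow_le_pow_left₀ hl h.1 n
  have hU (n : ℕ) : q ^ n ≤ u ^ n := pow_le_pow_left₀ hq0.le h.2 n
  have hε : (1 + w) * (q ^ 8 / (1 - q)) ≤ (1 + w) * (u ^ 8 / (1 - u)) := by
    have h1 : 0 < 1 - u := by linarith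
    have h2 : 1 - u ≤ 1 - q := by linarith [h.2]
    have h3 := h.2
    gcongr
  have hπ1 : (3.1415926535 : ℝ) ^ 2 ≤ Real.pi ^ 2 := by
    have := Real.pi_gt_d20
    gcongr; linarith
  have hπ2 : Real.pi ^ 2 ≤ (3.1415926536 : ℝ) ^ 2 := by
    have := Real.pi_lt_d20
    have := Real.pi_pos
    gcongr; linarith
  have hsum1 : q + -q ^ 2 / 2 + q ^ 3 / 3 + -q ^ 4 / 4 + q ^ 5 / 5 + -q ^ 6 / 6 + q ^ 7 / 7
      ≤ u - l ^ 2 / 2 + u ^ 3 / 3 - l ^ 4 / 4 + u ^ 5 / 5 - l ^ 6 / 6 + u ^ 7 / 7 := by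
    linarith [h.2, hL 2, hU 3, hL 4, hU 5, hL 6, hU 7]
  have hsum2 : l - u ^ 2 / 2 + l ^ 3 / 3 - u ^ 4 / 4 + l ^ 5 / 5 - u ^ 6 / 6 + l ^ 7 / 7 ≤
      q + -q ^ 2 / 2 + q ^ 3 / 3 + -q ^ 4 / 4 + q ^ 5 / 5 + -q ^ 6 / 6 + q ^ 7 / 7 := by
    linarith [h.1, hU 2, hL 3, hU 4, hL 5, hU 6, hL 7]
  have hw1 := mul_le_mul_of_nonneg_left hsum1 hw.le
  have hw2 := mul_le_mul_of_nonneg_left hsum2 hw.le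
  rw [abs_le] at hs
  constructor
  · linarith [hs.1, h.1, hU 2, hL 3, hU 4, hL 5, hU 6, hL 7]
  · linarith [hs.2, h.2, hL 2, hU 3, hL 4, hU 5, hL 6, hU 7]

theorem stationarity_neg : stationarity 2.599681 < 0 := by
  -- `e ^ (-2.599681 / 4) = 0.5220874115…`
  have h := exp_four_mul_mem_Icc (x := -0.64992025) (l := 0.522087407) (u := 0.522087416)
    (by norm_num [abs_le]) (by norm_num)
    (by norm_num [Finset.sum_range_succ, Nat.factorial])
    (by norm_num [Finset.sum_range_succ, Nat.factorial])
  rw [show (4 : ℝ) * -0.64992025 = -2.599681 by norm_num] at h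
  refine (stationarity_mem_Icc (by norm_num) (by norm_num) (by norm_num) h).2.trans_lt ?_
  norm_num

theorem stationarity_pos : 0 < stationarity 2.5996825 := by
  -- `e ^ (-2.5996825 / 4) = 0.5220872157…`
  have h := exp_four_mul_mem_Icc (x := -0.649920625) (l := 0.522087211) (u := 0.522087220)
    (by norm_num [abs_le]) (by norm_num)
    (by norm_num [Finset.sum_range_succ, Nat.factorial])
    (by norm_num [Finset.sum_range_succ, Nat.factorial])
  rw [show (4 : ℝ) * -0.649920625 = -2.5996825 by norm_num] at h
  refine lt_of_lt_of_le ?_ (stationarity_mem_Icc (by norm_num) (by norm_num) (by norm_num) h).1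
  norm_num

theorem continuous_stationarity : Continuous stationarity := by
  have hS := continuous_softplus
  have h : Continuous fun w => ∫ z in (0 : ℝ)..w, softplus (-z) :=
    intervalIntegral.continuous_primitive
      (fun _ _ => Continuous.intervalIntegrable (by fun_prop) _ _) 0
  unfold stationarity
  fun_prop

theorem exists_stationary : ∃ α : ℝ, 2.599681 < α ∧ α < 2.5996825 ∧
    ∫ u in (0 : ℝ)..1, u * Real.sigmoid (-α + 2 * α * u) = 1 / 3 := by
  obtain ⟨α, hα, h0⟩ := intermediate_value_Ioo (by norm_num : (2.599681 : ℝ) ≤ 2.5996825)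
    continuous_stationarity.continuousOn ⟨stationarity_neg, stationarity_pos⟩
  refine ⟨α, hα.1, hα.2, ?_⟩
  have hpos : 0 < α := by linarith [hα.1]
  rw [integral_mul_sigmoid hpos.ne', div_eq_iff (by positivity)]
  rw [stationarity] at h0
  linarith

/-! ### Slicing in the direction of the coefficient vector -/

theorem lrLogit_eq_inner {d : ℕ} (β₀ : ℝ) (β x : EuclideanSpace ℝ (Fin d)) :
    lrLogit β₀ β x = β₀ + inner ℝ β x := by
  simp [lrLogit, additiveLogit, PiLp.inner_apply, mul_comm]

/-- Measure-preserving coordinates `(t, w)` in which the first one is the component along `β`. -/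
theorem exists_slicing {n : ℕ} (β₀ : ℝ) {β : EuclideanSpace ℝ (Fin (n + 1))} (hβ : β ≠ 0) :
    ∃ T : EuclideanSpace ℝ (Fin (n + 1)) → ℝ × EuclideanSpace ℝ (Fin n),
      MeasurePreserving T ∧ ∀ x, lrLogit β₀ β x = β₀ + ‖β‖ * (T x).1 ∧
        ‖x‖ ^ 2 = (T x).1 ^ 2 + ‖(T x).2‖ ^ 2 := by
  have hn : ‖β‖ ≠ 0 := norm_ne_zero_iff.2 hβ
  obtain ⟨b, hb⟩ := Orthonormal.exists_orthonormalBasis_extension_of_card_eq (𝕜 := ℝ)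
    (E := EuclideanSpace ℝ (Fin (n + 1))) (ι := Fin (n + 1)) (by simp)
    (v := fun _ => ‖β‖⁻¹ • β) (s := {0}) (by
      rw [orthonormal_subsingleton_iff]
      intro i
      simp [Set.domRestrict, norm_smul, hn])
  have hb0 : b 0 = ‖β‖⁻¹ • β := hb 0 rfl
  refine ⟨fun x => ((b.repr x) 0, WithLp.toLp 2 fun i => (b.repr x) i.succ), ?_, fun x => ⟨?_, ?_⟩⟩
  · have h1 := b.measurePreserving_repr
    have h2 := PiLp.volume_preserving_ofLp (Fin (n + 1))
    have h3 := volume_preserving_piFinSuccAbove (fun _ : Fin (n + 1) => ℝ) 0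
    have h4 := (MeasurePreserving.id (volume : Measure ℝ)).prod
      (PiLp.volume_preserving_toLp (Fin n))
    exact h4.comp (h3.comp (h2.comp h1))
  · rw [lrLogit_eq_inner]
    simp only [OrthonormalBasis.repr_apply_apply, hb0, real_inner_smul_left]
    field_simp
  · rw [← b.repr.norm_map x, EuclideanSpace.norm_sq_eq, EuclideanSpace.norm_sq_eq,
      Fin.sum_univ_succ]
    simp

theorem measurable_of_mem_PL3 {g : ℝ → ℝ} (hg : g ∈ PL3) : Measurable g := by
  obtain ⟨x, y, -, rfl⟩ := hg
  unfold plFun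
  exact Measurable.ite measurableSet_Iic (by fun_prop)
    (Measurable.ite measurableSet_Iic (by fun_prop) (by fun_prop))

theorem measurable_sqError {g : ℝ → ℝ} (hg : Measurable g) : Measurable (sqError g) := by
  have := continuous_sigmoid.measurable
  unfold sqError
  fun_prop

theorem lintegral_sqError_affine (g : ℝ → ℝ) (hg : Measurable g) (β₀ : ℝ) {c : ℝ} (hc : 0 < c) :
    ∫⁻ t, sqError g (β₀ + c * t) = ENNReal.ofReal c⁻¹ * lineError g := by
  have h0 := measurable_sqError hg
  have h1 : Measurable fun t => sqError g (β₀ + t) := by fun_prop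
  rw [← lintegral_map (f := fun t => sqError g (β₀ + t)) h1 (measurable_const_mul c),
    Real.map_volume_mul_left hc.ne', lintegral_smul_measure, lintegral_add_left_eq_self,
    abs_of_pos (inv_pos.2 hc)]
  rfl

/-- The last factor is `1` when `n = 0` and `∞` otherwise. -/
theorem regionError_univ {n : ℕ} (β₀ : ℝ) {β : EuclideanSpace ℝ (Fin (n + 1))} (hβ : β ≠ 0)
    {g : ℝ → ℝ} (hg : Measurable g) :
    regionError β₀ β Set.univ g = ENNReal.ofReal ‖β‖⁻¹ * lineError g
      * volume (Set.univ : Set (EuclideanSpace ℝ (Fin n))) := by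
  obtain ⟨T, hT, hx⟩ := exists_slicing β₀ hβ
  have h0 := measurable_sqError hg
  have hm : Measurable fun p : ℝ × EuclideanSpace ℝ (Fin n) => sqError g (β₀ + ‖β‖ * p.1) := by
    fun_prop
  have h1 : regionError β₀ β Set.univ g = ∫⁻ x, sqError g (β₀ + ‖β‖ * (T x).1) := by
    rw [regionError, setLIntegral_univ]
    refine lintegral_congr fun x => ?_
    rw [(hx x).1, sqError]
  rw [h1, hT.lintegral_comp (f := fun p => sqError g (β₀ + ‖β‖ * p.1)) hm,
    Measure.volume_eq_prod, lintegral_prod _ hm.aemeasurable]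
  simp only [lintegral_const]
  rw [lintegral_mul_const _ (by fun_prop), lintegral_sqError_affine g hg β₀ (norm_pos_iff.2 hβ)]

theorem measurable_volume_ball_sqrt (n : ℕ) (R : ℝ) : Measurable fun t : ℝ =>
    volume (Metric.ball (0 : EuclideanSpace ℝ (Fin n)) √(R ^ 2 - t ^ 2)) := by
  have hmeas : MeasurableSet {p : ℝ × EuclideanSpace ℝ (Fin n) | ‖p.2‖ < √(R ^ 2 - p.1 ^ 2)} :=
    measurableSet_lt (by fun_prop) (by fun_prop)
  convert measurable_measure_prodMk_left (ν := volume) hmeas using 3 with t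
  ext w
  simp

theorem regionError_ball {n : ℕ} (β₀ : ℝ) {β : EuclideanSpace ℝ (Fin (n + 1))} (hβ : β ≠ 0)
    {g : ℝ → ℝ} (hg : Measurable g) {R : ℝ} (hR : 0 ≤ R) :
    regionError β₀ β (Metric.ball 0 R) g = ∫⁻ t, sqError g (β₀ + ‖β‖ * t)
      * volume (Metric.ball (0 : EuclideanSpace ℝ (Fin n)) √(R ^ 2 - t ^ 2)) := by
  obtain ⟨T, hT, hx⟩ := exists_slicing β₀ hβ
  have h0 := measurable_sqError hg
  set A : Set (ℝ × EuclideanSpace ℝ (Fin n)) := {p | ‖p.2‖ < √(R ^ 2 - p.1 ^ 2)} with hA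
  have hAm : MeasurableSet A := measurableSet_lt (by fun_prop) (by fun_prop)
  have hm : Measurable (A.indicator fun p => sqError g (β₀ + ‖β‖ * p.1)) :=
    Measurable.indicator (by fun_prop) hAm
  have h1 : regionError β₀ β (Metric.ball 0 R) g
      = ∫⁻ x, (A.indicator fun p => sqError g (β₀ + ‖β‖ * p.1)) (T x) := by
    rw [regionError, ← lintegral_indicator measurableSet_ball]
    refine lintegral_congr fun x => ?_
    have hiff : x ∈ Metric.ball 0 R ↔ T x ∈ A := by
      rw [mem_ball_zero_iff, hA, Set.mem_ofPred_eq, Real.lt_sqrt (norm_nonneg _),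
        ← sq_lt_sq₀ (norm_nonneg x) hR, (hx x).2, lt_sub_iff_add_lt']
    by_cases h : x ∈ Metric.ball 0 R
    · rw [Set.indicator_of_mem h, Set.indicator_of_mem (hiff.1 h), (hx x).1, sqError]
    · rw [Set.indicator_of_notMem h, Set.indicator_of_notMem (mt hiff.2 h)]
  rw [h1, hT.lintegral_comp hm, Measure.volume_eq_prod, lintegral_prod _ hm.aemeasurable]
  refine lintegral_congr fun t => ?_
  have h2 : ∀ w : EuclideanSpace ℝ (Fin n),
      A.indicator (fun p => sqError g (β₀ + ‖β‖ * p.1)) (t, w)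
      = (Metric.ball (0 : EuclideanSpace ℝ (Fin n)) √(R ^ 2 - t ^ 2)).indicator
        (fun _ => sqError g (β₀ + ‖β‖ * t)) w := fun w => by
    by_cases h : ‖w‖ < √(R ^ 2 - t ^ 2)
    · rw [Set.indicator_of_mem (show (t, w) ∈ A from h),
        Set.indicator_of_mem (mem_ball_zero_iff.2 h)]
    · rw [Set.indicator_of_notMem (show (t, w) ∉ A from h),
        Set.indicator_of_notMem (mt mem_ball_zero_iff.1 h)]
  simp only [h2]
  rw [lintegral_indicator measurableSet_ball, setLIntegral_const]

theorem ofReal_sliceVolume {n : ℕ} {R : ℝ} (hR : 0 < R) :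
    ENNReal.ofReal (sliceVolume (n + 1) R)
      = volume (Metric.ball (0 : EuclideanSpace ℝ (Fin n)) R) := by
  have e : ((n + 1 : ℕ) : ℝ) - 1 = n := by push_cast; ring
  rw [sliceVolume, e, Real.rpow_natCast, Real.rpow_div_two_eq_sqrt _ Real.pi_pos.le,
    Real.rpow_natCast]
  rcases Nat.eq_zero_or_pos n with rfl | hn
  -- `EuclideanSpace.volume_ball` does not cover dimension zero, where the volume is a Dirac mass.
  · rw [volume_euclideanSpace_eq_dirac, Measure.dirac_apply_of_mem (by simpa using hR)]
    simp
  · have : Nonempty (Fin n) := ⟨⟨0, hn⟩⟩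
    rw [EuclideanSpace.volume_ball, Fintype.card_fin, mul_comm, ENNReal.ofReal_mul (by positivity),
      ENNReal.ofReal_pow hR.le]

theorem tendsto_volume_ball_sqrt_div (n : ℕ) (t : ℝ) : Tendsto (fun R : ℝ =>
    volume (Metric.ball (0 : EuclideanSpace ℝ (Fin n)) √(R ^ 2 - t ^ 2))
      / ENNReal.ofReal (sliceVolume (n + 1) R)) atTop (𝓝 1) := by
  have hl : Tendsto (fun R : ℝ => ENNReal.ofReal (√(1 - (t / R) ^ 2) ^ n)) atTop (𝓝 1) := by
    have h1 : Tendsto (fun R : ℝ => t / R) atTop (𝓝 0) := tendsto_const_nhds.div_atTop tendsto_id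
    have h2 : Continuous fun s : ℝ => ENNReal.ofReal (√(1 - s ^ 2) ^ n) :=
      ENNReal.continuous_ofReal.comp (by fun_prop)
    have h3 := (h2.tendsto 0).comp h1
    rw [show ENNReal.ofReal (√(1 - (0 : ℝ) ^ 2) ^ n) = 1 by simp] at h3
    exact h3
  refine hl.congr' ?_
  filter_upwards [eventually_gt_atTop |t|] with R hR
  have hR0 : 0 < R := (abs_nonneg t).trans_lt hR
  have hlt : 0 < R ^ 2 - t ^ 2 := by
    have := sq_lt_sq' (by linarith [neg_abs_le t]) ((le_abs_self t).trans_lt hR)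
    linarith
  have hV0 : volume (Metric.ball (0 : EuclideanSpace ℝ (Fin n)) 1) ≠ 0 :=
    (Metric.measure_ball_pos _ _ one_pos).ne'
  have hV1 : volume (Metric.ball (0 : EuclideanSpace ℝ (Fin n)) 1) ≠ ⊤ := measure_ball_lt_top.ne
  rw [ofReal_sliceVolume hR0, Measure.addHaar_ball_of_pos _ _ hR0,
    Measure.addHaar_ball_of_pos _ _ (Real.sqrt_pos.2 hlt), ENNReal.mul_div_mul_right _ _ hV0 hV1,
    ← ENNReal.ofReal_div_of_pos (by positivity), finrank_euclideanSpace, Fintype.card_fin,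
    ← div_pow]
  congr 2
  have h1 : 1 - (t / R) ^ 2 = (R ^ 2 - t ^ 2) / R ^ 2 := by field_simp
  rw [h1, Real.sqrt_div hlt.le, Real.sqrt_sq hR0.le]

theorem volume_ball_sqrt_div_le (n : ℕ) {R : ℝ} (hR : 0 < R) (t : ℝ) :
    volume (Metric.ball (0 : EuclideanSpace ℝ (Fin n)) √(R ^ 2 - t ^ 2))
      / ENNReal.ofReal (sliceVolume (n + 1) R) ≤ 1 := by
  rw [ofReal_sliceVolume hR]
  refine ENNReal.div_le_of_le_mul ?_
  rw [one_mul]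
  refine measure_mono (Metric.ball_subset_ball ?_)
  exact (Real.sqrt_le_sqrt (sub_le_self _ (sq_nonneg t))).trans_eq (Real.sqrt_sq hR.le)

theorem tendsto_regionError_ball_div {n : ℕ} (β₀ : ℝ) {β : EuclideanSpace ℝ (Fin (n + 1))}
    (hβ : β ≠ 0) {g : ℝ → ℝ} (hg : Measurable g) :
    Tendsto (fun R : ℝ => regionError β₀ β (Metric.ball 0 R) g
      / ENNReal.ofReal (sliceVolume (n + 1) R)) atTop
      (𝓝 (ENNReal.ofReal ‖β‖⁻¹ * lineError g)) := by
  rw [← lintegral_sqError_affine g hg β₀ (norm_pos_iff.2 hβ)]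
  have h0 := measurable_sqError hg
  set W : ℝ → ℝ → ℝ≥0∞ := fun R t =>
    volume (Metric.ball (0 : EuclideanSpace ℝ (Fin n)) √(R ^ 2 - t ^ 2))
      / ENNReal.ofReal (sliceVolume (n + 1) R) with hW
  have hWm (R : ℝ) : Measurable (W R) := (measurable_volume_ball_sqrt n R).div_const _
  have heq : (fun R : ℝ => ∫⁻ t, sqError g (β₀ + ‖β‖ * t) * W R t) =ᶠ[atTop]
      fun R : ℝ => regionError β₀ β (Metric.ball 0 R) g
        / ENNReal.ofReal (sliceVolume (n + 1) R) := by
    filter_upwards [eventually_ge_atTop 0] with R hR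
    have hb := measurable_volume_ball_sqrt n R
    have hm : Measurable fun t => sqError g (β₀ + ‖β‖ * t)
        * volume (Metric.ball (0 : EuclideanSpace ℝ (Fin n)) √(R ^ 2 - t ^ 2)) := by fun_prop
    rw [regionError_ball β₀ hβ hg hR, div_eq_mul_inv,
      ← lintegral_mul_const _ hm]
    refine lintegral_congr fun t => ?_
    rw [mul_assoc, ← div_eq_mul_inv]
  -- The weights `W R` are at most `1` and tend to `1`, so Fatou's lemma gives the limit, also when
  -- it is infinite.
  refine Tendsto.congr' heq (tendsto_of_le_liminf_of_limsup_le ?_ ?_)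
  · refine le_trans (le_of_eq (lintegral_congr fun t => ?_)) (lintegral_liminf_le fun R =>
      (h0.comp (by fun_prop : Measurable fun t => β₀ + ‖β‖ * t)).mul (hWm R))
    have h1 := ENNReal.Tendsto.const_mul (a := sqError g (β₀ + ‖β‖ * t))
      (tendsto_volume_ball_sqrt_div n t) (Or.inl one_ne_zero)
    rw [mul_one] at h1
    exact h1.liminf_eq.symm
  · refine limsup_le_of_le (h := ?_)
    filter_upwards [eventually_gt_atTop 0] with R hR
    refine lintegral_mono fun t => ?_
    exact mul_le_of_le_one_right' (volume_ball_sqrt_div_le n hR t)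

/-! ### The linearised model and its optimality -/

theorem lrLinearised_eq_clipSigmoid {d : ℕ} (α β₀ : ℝ) (β x : EuclideanSpace ℝ (Fin d)) :
    lrLinearised α β₀ β x = clipSigmoid α (lrLogit β₀ β x) := by
  rw [lrLinearised, linearisedModel, clipSigmoid, lrLogit, additiveLogit]
  congr 1
  have : ∑ i, β i / (2 * α) * id (x i) = (∑ i, β i * id (x i)) / (2 * α) := by
    rw [Finset.sum_div]
    exact Finset.sum_congr rfl fun i _ => by ring
  rw [this]
  ring

/-- Outside `[-γ, γ]` both functions are clipped to the same value; inside, clipping is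
1-Lipschitz. -/
theorem abs_clipSigmoid_sub_le {α γ : ℝ} (hα : 0 < α) (hαγ : α ≤ γ) (z : ℝ) :
    |clipSigmoid α z - clipSigmoid γ z| ≤ (γ - α) / (2 * α) := by
  have hγ : 0 < γ := hα.trans_le hαγ
  have h0 : 0 ≤ (γ - α) / (2 * α) := div_nonneg (by linarith) (by linarith)
  rw [clipSigmoid_eq_ramp hα, clipSigmoid_eq_ramp hγ]
  rcases le_or_gt z (-γ) with h1 | h1
  · rw [ramp_of_le (by linarith) h1, ramp_of_le (by linarith) (by linarith)]
    simpa
  rcases le_or_gt γ z with h2 | h2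
  · rw [ramp_of_ge (by linarith) h2, ramp_of_ge (by linarith) (by linarith)]
    simpa
  have hlip : ∀ p q, |unitProj p - unitProj q| ≤ |p - q| := fun p q => by
    refine (abs_max_sub_max_le_max _ _ _ _).trans ?_
    rw [sub_self, abs_zero, max_eq_right (abs_nonneg _)]
    refine (abs_min_sub_min_le_max _ _ _ _).trans ?_
    rw [sub_self, abs_zero, max_eq_right (abs_nonneg _)]
  refine (hlip _ _).trans ?_
  have e : (z - -α) / (α - -α) - (z - -γ) / (γ - -γ) = z / γ * ((γ - α) / (2 * α)) := by
    field_simp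
    ring
  have hz : |z / γ| ≤ 1 := by
    rw [abs_div, abs_of_pos hγ, div_le_one hγ, abs_le]
    exact ⟨h1.le, h2.le⟩
  rw [e, abs_mul, abs_of_nonneg h0]
  exact mul_le_of_le_one_left h0 hz

theorem theorem2p4 :
    ∃ αs : ℝ, 2.5996 < αs ∧ αs < 2.5997 ∧ |αs - 80000 / 30773| < 1 / 10 ^ 6 ∧
      clipSigmoid αs ∈ PL3 ∧
      ∀ (d : ℕ) (β₀ : ℝ) (β : EuclideanSpace ℝ (Fin d)),
        -- the induced linearised model is the optimal approximator
        (∀ x, lrLinearised αs β₀ β x = clipSigmoid αs (lrLogit β₀ β x)) ∧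
        (∀ x, |lrLinearised (80000 / 30773) β₀ β x - clipSigmoid αs (lrLogit β₀ β x)|
          < 1 / 10 ^ 6) ∧
        (β ≠ 0 →
          -- unique minimiser of the limit of the normalised errors over balls
          (∃ E : (ℝ → ℝ) → ℝ≥0∞,
            (∀ g ∈ PL3, Tendsto
              (fun R : ℝ => regionError β₀ β (Metric.ball 0 R) g
                / ENNReal.ofReal (sliceVolume d R)) atTop (𝓝 (E g))) ∧
            E (clipSigmoid αs) < ⊤ ∧
            ∀ g ∈ PL3, g ≠ clipSigmoid αs → E (clipSigmoid αs) < E g) ∧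
          -- minimiser of the error over the whole space, unique in dimension one
          (∀ g ∈ PL3, regionError β₀ β Set.univ (clipSigmoid αs)
            ≤ regionError β₀ β Set.univ g) ∧
          (d = 1 → ∀ g ∈ PL3, g ≠ clipSigmoid αs →
            regionError β₀ β Set.univ (clipSigmoid αs) < regionError β₀ β Set.univ g)) := by
  obtain ⟨α, hl, hu, hα⟩ := exists_stationary
  have hpos : 0 < α := by linarith
  have hmem : clipSigmoid α ∈ PL3 := by
    rw [clipSigmoid_eq_ramp hpos]
    exact ramp_mem_PL3 (by linarith)
  have hdist : |α - 80000 / 30773| < 1 / 10 ^ 6 := by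
    rw [abs_lt]; constructor <;> linarith
  refine ⟨α, by linarith, by linarith, hdist, hmem, fun d β₀ β =>
    ⟨lrLinearised_eq_clipSigmoid α β₀ β, fun x => ?_, fun hβ => ?_⟩⟩
  · rw [lrLinearised_eq_clipSigmoid]
    obtain ⟨h1, h2⟩ := abs_lt.1 hdist
    rcases le_total α (80000 / 30773) with h | h
    · rw [abs_sub_comm]
      refine (abs_clipSigmoid_sub_le hpos h _).trans_lt ?_
      rw [div_lt_iff₀ (by positivity)]
      linarith
    · refine (abs_clipSigmoid_sub_le (by norm_num) h _).trans_lt ?_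
      rw [div_lt_iff₀ (by positivity)]
      linarith
  obtain _ | n := d
  · exact absurd (Subsingleton.elim β 0) hβ
  have hc0 : ENNReal.ofReal ‖β‖⁻¹ ≠ 0 := by simpa using hβ
  have hlt : ∀ g ∈ PL3, g ≠ clipSigmoid α → ENNReal.ofReal ‖β‖⁻¹ * lineError (clipSigmoid α)
      < ENNReal.ofReal ‖β‖⁻¹ * lineError g := fun g hg hne =>
    ENNReal.mul_lt_mul_right hc0 ENNReal.ofReal_ne_top (lineError_clipSigmoid_lt hpos hα hg hne)
  refine ⟨⟨fun g => ENNReal.ofReal ‖β‖⁻¹ * lineError g, fun g hg =>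
    tendsto_regionError_ball_div β₀ hβ (measurable_of_mem_PL3 hg), ?_, hlt⟩, fun g hg => ?_,
    fun hd g hg hne => ?_⟩
  · change ENNReal.ofReal ‖β‖⁻¹ * lineError (clipSigmoid α) < ⊤
    rw [clipSigmoid_eq_ramp hpos, (lineError_ramp (by linarith)).2]
    exact ENNReal.mul_lt_top ENNReal.ofReal_lt_top ENNReal.ofReal_lt_top
  · rcases eq_or_ne g (clipSigmoid α) with rfl | hne
    · exact le_rfl
    rw [regionError_univ β₀ hβ (measurable_of_mem_PL3 hmem),
      regionError_univ β₀ hβ (measurable_of_mem_PL3 hg)]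
    gcongr
    exact (lineError_clipSigmoid_lt hpos hα hg hne).le
  · obtain rfl : n = 0 := by omega
    rw [regionError_univ β₀ hβ (measurable_of_mem_PL3 hmem),
      regionError_univ β₀ hβ (measurable_of_mem_PL3 hg), volume_euclideanSpace_eq_dirac,
      measure_univ, mul_one, mul_one]
    exact hlt g hg hne
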